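/- **Model.** An instance consists of a dimension $D\ge 2$; users $\mathcal U_0=\{1,\dots,U\}$ and creators $\mathcal C_0=\{1,\dots,C\}$ with $U,C\ge 1$; types $u_i,c_j\in\mathbb R^D_{\ge 0}$ of Euclidean norm $1$; and parameters $K\ge 1$ (number of recommendations per user), $\bar e\in[0,1]$ and $\bar a\in\mathbb N_0$. A recommendation algorithm is a sequence $\mathbf R=(R_0,R_1,\dots)$ in which $R_t$ assigns to every user $i\in\mathcal U_t$ a set $R_t(i)\subseteq\mathcal C_t$ of at most $K$ creators, where $$\mathcal U_{t+1}=\{i\in\mathcal U_t:\ |R_t(i)|=K,\ u_i^Tc_j\ge\bar e\ \ \forall j\in R_t(i)\},\qquad \mathcal C_{t+1}=\{j\in\mathcal C_t:\ |\{i\in\mathcal U_t: j\in R_t(i)\}|\ge\bar a\}.$$ Its long-term engagement is $E(\mathbf R)=\lim_{T\to\infty}\frac1T\sum_{t=0}^{T-1}\sum_{i\in\mathcal U_t}\sum_{j\in R_t(i)}u_i^Tc_j$, when this limit exists. A forward-looking (FL) algorithm is a recommendation algorithm that maximizes $E$ (among all recommendation algorithms for which the limit exists). **Neighborhood balls.**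 Put $d=2\sin(\tfrac12\arccos\bar e)$, so that $u_i^Tc_j\ge\bar e$ if and only if $\|u_i-c_j\|\le d$, and let $B(u_i)$ be the closed Euclidean ball with centre $u_i$ and radius $2\sin(\tfrac14\arccos\bar e)$; the boundary of $B(u_i)$ meets the unit sphere in a sphere of diameter $d$. The *density assumption* says that for every user $i$ the ball $B(u_i)$ contains at least $\bar a$ users and at least $K$ creators. **The local-clustering (LC) algorithm.** Start with $R(i)=\emptyset$ for all users and examine the users one by one in an arbitrary order. When user $i$ is examined and $R(i)=\emptyset$, let $\mathcal U_i$ be the set of users $j$ with $u_j\in B(u_i)$ and $R(j)=\emptyset$, and let $\mathcal C_i$ be the set of creators in $B(u_i)$. If $|\mathcal U_i|\ge\bar a$ and $|\mathcal C_i|\ge K$, choose an arbitrary $\mathcal C_i'\subseteq\mathcal C_i$ with $|\mathcal C_i'|=K$ and set $R(j)=\mathcal C_i'$ for all $j\in\mathcal U_i$; otherwise do nothing. The final $R$ is used at all times: $\mathbf{LC}=(R,R,\dots)$. **Theorem (Approximation of the local-clustering algorithm).** There is a function $r(\bar e,D)$, depending only on $\bar e$ and $D$, with $r(\bar e,D)>0$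 for all $0<\bar e\le1$ and $D\ge2$, and with $r(\bar e,3)\ge \bar e/37$ for all $\bar e\in[0,1]$, such that the following holds for every instance of dimension $D$ that satisfies the density assumption. An FL algorithm exists. For every order of the users and all choices made by the LC algorithm, $\mathbf{LC}$ is a recommendation algorithm, its long-term engagement exists, and for every FL algorithm $\mathbf{FL}$: $E(\mathbf{FL})>0$ if $\bar e>0$, and, whenever $E(\mathbf{FL})>0$, $$\frac{E(\mathbf{LC})}{E(\mathbf{FL})}\ \ge\ r(\bar e,D).$$ -/

import Mathlib

noncomputable section

namespace ContentRec

/-- The happy distance `d = 2 sin (arccos ē / 2)`: unit vectors satisfy `⟪u, c⟫ ≥ ē` exactly when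
`‖u - c‖ ≤ d` (for `0 ≤ ē ≤ 1`). -/
def happyDistance (ebar : ℝ) : ℝ := 2 * Real.sin (Real.arccos ebar / 2)

/-- The neighborhood radius: a ball of this radius centred at a unit vector meets the unit sphere
in a cap of angular radius `arccos ē / 2`, and the boundary of that cap is a sphere
of diameter `happyDistance ē`; see `isGreatest_dist_boundary`. -/
def neighborhoodRadius (ebar : ℝ) : ℝ := 2 * Real.sin (Real.arccos ebar / 4)

/-- For a unit vector `u` in dimension `D ≥ 2`, two unit vectors at distance exactly
`neighborhoodRadius ē` from `u` are at distance at most `happyDistance ē`, with equality attained. -/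
theorem isGreatest_dist_boundary {D : ℕ} (hD : 2 ≤ D) {ebar : ℝ} (h0 : 0 ≤ ebar)
    (u : EuclideanSpace ℝ (Fin D)) (hu : ‖u‖ = 1) :
    IsGreatest {δ : ℝ | ∃ x y : EuclideanSpace ℝ (Fin D), ‖x‖ = 1 ∧ ‖y‖ = 1 ∧
      ‖x - u‖ = neighborhoodRadius ebar ∧ ‖y - u‖ = neighborhoodRadius ebar ∧ δ = ‖x - y‖}
      (happyDistance ebar) := by
  set a := Real.arccos ebar / 2 with ha
  have ha0 : 0 ≤ a := by have := Real.arccos_nonneg ebar; positivity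
  have ha1 : a ≤ Real.pi / 4 := by
    have := Real.arccos_le_pi_div_two.2 h0; linarith
  have hpi := Real.pi_pos
  have hs : 0 ≤ Real.sin a := Real.sin_nonneg_of_nonneg_of_le_pi ha0 (by linarith)
  have hr : neighborhoodRadius ebar = 2 * Real.sin (a / 2) := by
    unfold neighborhoodRadius; rw [ha]; ring_nf
  have hd : happyDistance ebar = 2 * Real.sin a := rfl
  have hr0 : 0 ≤ 2 * Real.sin (a / 2) := by
    have := Real.sin_nonneg_of_nonneg_of_le_pi (x := a / 2) (by linarith) (by linarith)
    linarith
  have hsq : (2 * Real.sin (a / 2)) ^ 2 = 2 - 2 * Real.cos a := by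
    have h1 : Real.cos a = 2 * Real.cos (a / 2) ^ 2 - 1 := by
      rw [← Real.cos_two_mul]; ring_nf
    have h2 := Real.sin_sq_add_cos_sq (a / 2)
    nlinarith
  have hsc := Real.sin_sq_add_cos_sq a
  have key : ∀ x : EuclideanSpace ℝ (Fin D), ‖x‖ = 1 →
      (‖x - u‖ = 2 * Real.sin (a / 2) ↔ inner ℝ x u = Real.cos a) := by
    intro x hx
    have h1 : ‖x - u‖ ^ 2 = 2 - 2 * inner ℝ x u := by
      rw [norm_sub_sq_real, hx, hu]; ring
    constructor
    · intro h; rw [h, hsq] at h1; linarith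
    · intro h
      rw [h, ← hsq] at h1
      exact (pow_left_inj₀ (norm_nonneg _) hr0 two_ne_zero).1 h1
  rw [hr, hd]
  constructor
  · obtain ⟨v, hv, hvu⟩ : ∃ v : EuclideanSpace ℝ (Fin D), ‖v‖ = 1 ∧ inner ℝ v u = 0 := by
      have hne : (ℝ ∙ u)ᗮ ≠ ⊥ := by
        intro h
        have h1 := Submodule.finrank_add_finrank_orthogonal (ℝ ∙ u)
        rw [h, finrank_bot, finrank_euclideanSpace_fin] at h1
        have h2 := finrank_span_singleton (K := ℝ) (v := u) (by rintro rfl; simp at hu)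
        omega
      obtain ⟨w, hw, hw0⟩ := Submodule.exists_mem_ne_zero_of_ne_bot hne
      refine ⟨‖w‖⁻¹ • w, by simp [norm_smul, hw0], ?_⟩
      rw [inner_smul_left, real_inner_comm, Submodule.mem_orthogonal_singleton_iff_inner_right.1 hw]
      simp
    have hn : ∀ s : ℝ, s ^ 2 = Real.sin a ^ 2 → ‖Real.cos a • u + s • v‖ = 1 := by
      intro s hs'
      have : ‖Real.cos a • u + s • v‖ ^ 2 = 1 := by
        rw [norm_add_sq_real, norm_smul, norm_smul, hu, hv, inner_smul_left, inner_smul_right,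
          real_inner_comm, hvu]
        simp only [Real.norm_eq_abs, mul_one, sq_abs, mul_zero, add_zero]
        linarith
      exact (pow_left_inj₀ (norm_nonneg _) zero_le_one two_ne_zero).1 (by rw [this]; norm_num)
    have hi : ∀ s : ℝ, inner ℝ (Real.cos a • u + s • v) u = Real.cos a := by
      intro s
      rw [inner_add_left, inner_smul_left, inner_smul_left, hvu, real_inner_self_eq_norm_sq, hu]
      simp
    refine ⟨Real.cos a • u + Real.sin a • v, Real.cos a • u + (-Real.sin a) • v,
      hn _ rfl, hn _ (by ring), (key _ (hn _ rfl)).2 (hi _), (key _ (hn _ (by ring))).2 (hi _), ?_⟩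
    have : Real.cos a • u + Real.sin a • v - (Real.cos a • u + (-Real.sin a) • v)
        = (2 * Real.sin a) • v := by module
    rw [this, norm_smul, hv, Real.norm_eq_abs, abs_of_nonneg (by linarith), mul_one]
  · rintro δ ⟨x, y, hx, hy, hxu, hyu, rfl⟩
    have hx' := (key x hx).1 hxu
    have hy' := (key y hy).1 hyu
    have h1 : ‖x + y - (2 * Real.cos a) • u‖ ^ 2 = ‖x + y‖ ^ 2 - 4 * Real.cos a ^ 2 := by
      rw [norm_sub_sq_real, norm_smul, hu, inner_smul_right, inner_add_left, hx', hy']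
      simp only [Real.norm_eq_abs, mul_one, sq_abs]
      ring
    have h2 := parallelogram_law_with_norm ℝ x y
    have h3 := sq_nonneg ‖x + y - (2 * Real.cos a) • u‖
    refine abs_le_of_sq_le_sq' ?_ (by linarith) |>.2
    rw [hx, hy] at h2
    nlinarith

/-- A deterministic instance of the two-sided recommendation model in dimension `D`. -/
structure Instance (D : ℕ) where
  /-- number of users -/
  U : ℕ
  /-- number of creators -/
  C : ℕ
  /-- number of creators recommended to each user per time step -/
  K : ℕ
  /-- user constraint value -/
  ebar : ℝ
  /-- creator constraint value -/
  abar : ℕ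
  /-- user types -/
  user : Fin U → EuclideanSpace ℝ (Fin D)
  /-- creator types -/
  creator : Fin C → EuclideanSpace ℝ (Fin D)
  U_pos : 1 ≤ U
  C_pos : 1 ≤ C
  K_pos : 1 ≤ K
  ebar_nonneg : 0 ≤ ebar
  ebar_le_one : ebar ≤ 1
  user_nonneg : ∀ i l, 0 ≤ user i l
  creator_nonneg : ∀ j l, 0 ≤ creator j l
  user_norm : ∀ i, ‖user i‖ = 1
  creator_norm : ∀ j, ‖creator j‖ = 1

namespace Instance

variable {D : ℕ} (I : Instance D)

/-- One round of recommendations: a set of creators for each user. -/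
abbrev Rec : Type := Fin I.U → Finset (Fin I.C)

/-! ### Dynamics of the platform -/

/-- User `i` is happy with creator `j`. -/
def Happy (i : Fin I.U) (j : Fin I.C) : Prop :=
  I.ebar ≤ inner ℝ (I.user i) (I.creator j)

open Classical in
/-- The users of `S` whose participation constraint is satisfied by `R`. -/
def stayingUsers (S : Finset (Fin I.U)) (R : I.Rec) : Finset (Fin I.U) :=
  S.filter fun i => (R i).card = I.K ∧ ∀ j ∈ R i, I.Happy i j

open Classical in
/-- The audience size of creator `j` when the users of `S` receive the recommendations `R`. -/
def audience (S : Finset (Fin I.U)) (R : I.Rec) (j : Fin I.C) : ℕ :=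
  (S.filter fun i => j ∈ R i).card

open Classical in
/-- The creators of `T` whose participation constraint is satisfied when the users of `S`
receive the recommendations `R`. -/
def stayingCreators (S : Finset (Fin I.U)) (T : Finset (Fin I.C)) (R : I.Rec) :
    Finset (Fin I.C) :=
  T.filter fun j => I.abar ≤ I.audience S R j

/-- The sets of users and creators present at time `t` under the sequence `R`. -/
def population (R : ℕ → I.Rec) : ℕ → Finset (Fin I.U) × Finset (Fin I.C)
  | 0 => (Finset.univ, Finset.univ)
  | t + 1 =>
    (I.stayingUsers (population R t).1 (R t),
      I.stayingCreators (population R t).1 (population R t).2 (R t))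

/-- `R` is a recommendation algorithm: at each time every user who is present is recommended at
most `K` creators, all of them present. (A user who gets fewer than `K` of them leaves.) -/
def IsRecAlgorithm (R : ℕ → I.Rec) : Prop :=
  ∀ t, ∀ i ∈ (I.population R t).1, R t i ⊆ (I.population R t).2 ∧ (R t i).card ≤ I.K

/-- Total engagement of the users of `S` under the recommendations `R`. -/
def engagement (S : Finset (Fin I.U)) (R : I.Rec) : ℝ :=
  ∑ i ∈ S, ∑ j ∈ R i, inner ℝ (I.user i) (I.creator j)

/-- Average total engagement over the times `0, …, T - 1`. -/
def averageEngagement (R : ℕ → I.Rec) (T : ℕ) : ℝ :=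
  (1 / (T : ℝ)) * ∑ t ∈ Finset.range T, I.engagement (I.population R t).1 (R t)

/-- The long-term total engagement of `R` exists and equals `e`. -/
def HasLongTermEngagement (R : ℕ → I.Rec) (e : ℝ) : Prop :=
  Filter.Tendsto (I.averageEngagement R) Filter.atTop (nhds e)

/-- `F` is a forward-looking (FL) recommendation algorithm: it maximizes long-term total
engagement. -/
def IsForwardLooking (F : ℕ → I.Rec) : Prop :=
  I.IsRecAlgorithm F ∧ ∃ e, I.HasLongTermEngagement F e ∧
    ∀ R e', I.IsRecAlgorithm R → I.HasLongTermEngagement R e' → e' ≤ e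

/-! ### Neighborhood balls and the local-clustering algorithm -/

/-- The neighborhood ball centred at user `i`. -/
def ball (i : Fin I.U) : Set (EuclideanSpace ℝ (Fin D)) :=
  Metric.closedBall (I.user i) (neighborhoodRadius I.ebar)

open Classical in
/-- The users in the neighborhood ball of user `i`. -/
def usersIn (i : Fin I.U) : Finset (Fin I.U) :=
  Finset.univ.filter fun j => I.user j ∈ I.ball i

open Classical in
/-- The creators in the neighborhood ball of user `i`. -/
def creatorsIn (i : Fin I.U) : Finset (Fin I.C) :=
  Finset.univ.filter fun k => I.creator k ∈ I.ball i

/-- The density assumption. -/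
def Dense : Prop :=
  ∀ i, I.abar ≤ (I.usersIn i).card ∧ I.K ≤ (I.creatorsIn i).card

open Classical in
/-- The users in the neighborhood ball of user `i` that are unassigned in `R`. -/
def unassignedIn (R : I.Rec) (i : Fin I.U) : Finset (Fin I.U) :=
  (I.usersIn i).filter fun j => R j = ∅

/-- `pick i` is the set of `K` creators that the local-clustering algorithm uses if it assigns the
neighborhood ball of user `i`. As every user is examined once, letting `pick` range over all
such functions gives all possible arbitrary choices of the algorithm. -/
def IsPick (pick : Fin I.U → Finset (Fin I.C)) : Prop :=
  ∀ i, I.K ≤ (I.creatorsIn i).card → pick i ⊆ I.creatorsIn i ∧ (pick i).card = I.K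

open Classical in
/-- The local-clustering algorithm examines user `i` when the current recommendations are `R`. -/
def lcStep (pick : Fin I.U → Finset (Fin I.C)) (R : I.Rec) (i : Fin I.U) : I.Rec :=
  if R i = ∅ ∧ I.abar ≤ (I.unassignedIn R i).card ∧ I.K ≤ (I.creatorsIn i).card then
    fun j => if j ∈ I.unassignedIn R i then pick i else R j
  else R

/-- The recommendations returned by the local-clustering algorithm when it examines the users in
the order `order 0, order 1, …` and makes the choices `pick`. -/
def lcOutput (order : Equiv.Perm (Fin I.U)) (pick : Fin I.U → Finset (Fin I.C)) : I.Rec :=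
  (List.ofFn order).foldl (I.lcStep pick) fun _ => ∅

/-- The local-clustering (LC) recommendation algorithm: its matching is used at all times. -/
def localClustering (order : Equiv.Perm (Fin I.U)) (pick : Fin I.U → Finset (Fin I.C)) :
    ℕ → I.Rec :=
  fun _ => I.lcOutput order pick

end Instance

end ContentRec

end

noncomputable section

namespace ContentRec

/-! ### Spherical geometry: chords, angles and partitions -/

section Geometry

open InnerProductGeometry

variable {E : Type*} [NormedAddCommGroup E] [InnerProductSpace ℝ E]

/-! Finitely many populations decrease in time, so every recommendation algorithm ends in a constant
population, where its matching is stable (`IsStable`). Hence long-term engagement is at most that of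
the best stable matching, which exists by finiteness and is at most `U * K`.

The LC matching is stable, and each assigned user contributes at least `ē K`. It remains to show
that a fixed share of the users is assigned. Put `θ = arccos ē / 2`, the angular radius of a
neighborhood ball. Each processed ball brings at least `ā` newly assigned users. By density, a user
left unassigned has fewer than `ā` unassigned users in her ball but at least `ā` users in all, so
her ball contains an assigned user; the center of that user's cluster lies at angle between `θ` and
`2θ` from her (`exists_mem_center`). If the region around each center that can hold unassigned users
splits into `N` pieces of angular diameter at most `θ`, each piece lies in the ball of any of its
users and so holds at most `ā` unassigned ones. Thus at most `N` users are unassigned per assigned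
user (`IsClustering.card_le`), and the ratio is at least `ē / (N + 1)`.

For `D = 3` the annulus around a center needs `N = 36` pieces (`exists_partition_annulus`); for
general `D`, compactness of the sphere gives some `N` (`exists_partition_sphere`). -/

theorem cos_angle_of_norm_eq_one {x y : E} (hx : ‖x‖ = 1) (hy : ‖y‖ = 1) :
    Real.cos (angle x y) = inner ℝ x y := by
  rw [cos_angle, hx, hy]; simp

/-- Chordal and angular distance between unit vectors. -/
theorem norm_sub_le_two_mul_sin_half_iff {x y : E} (hx : ‖x‖ = 1) (hy : ‖y‖ = 1) {θ : ℝ}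
    (h0 : 0 ≤ θ) (h1 : θ ≤ Real.pi) :
    ‖x - y‖ ≤ 2 * Real.sin (θ / 2) ↔ angle x y ≤ θ := by
  have hs : 0 ≤ 2 * Real.sin (θ / 2) := by
    have := Real.sin_nonneg_of_nonneg_of_le_pi (x := θ / 2) (by linarith) (by linarith)
    linarith
  have hsq : (2 * Real.sin (θ / 2)) ^ 2 = 2 - 2 * Real.cos θ := by
    have h2 : Real.cos θ = 2 * Real.cos (θ / 2) ^ 2 - 1 := by
      rw [← Real.cos_two_mul]; ring_nf
    have h3 := Real.sin_sq_add_cos_sq (θ / 2)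
    nlinarith
  have hn : ‖x - y‖ ^ 2 = 2 - 2 * Real.cos (angle x y) := by
    rw [norm_sub_sq_real, cos_angle_of_norm_eq_one hx hy, hx, hy]; ring
  rw [← pow_le_pow_iff_left₀ (norm_nonneg _) hs two_ne_zero, hsq, hn,
    ← Real.strictAntiOn_cos.le_iff_ge ⟨h0, h1⟩ ⟨angle_nonneg x y, angle_le_pi x y⟩]
  constructor <;> intro h <;> linarith

/-! ### Sectors of an annulus on the two-dimensional sphere -/

/-- The index, among `n` equal sectors, of the argument of a complex number. -/
def sector (n : ℕ) (z : ℂ) : ℤ := ⌈(z.arg + Real.pi) / (2 * Real.pi / n)⌉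

/-- `Complex.arg` takes values in `(-π, π]`, open on the left, so the ceiling starts at `1` and ends
at `n`. -/
theorem sector_mem {n : ℕ} (hn : 0 < n) (z : ℂ) : sector n z ∈ Finset.Icc (1 : ℤ) n := by
  have hpi := Real.pi_pos
  have hn' : (0 : ℝ) < n := by exact_mod_cast hn
  have h1 := Complex.neg_pi_lt_arg z
  have h2 := Complex.arg_le_pi z
  rw [Finset.mem_Icc]
  constructor
  · exact Int.one_le_ceil_iff.2 (div_pos (by linarith) (by positivity))
  · refine Int.ceil_le.2 ?_
    rw [div_le_iff₀ (by positivity)]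
    push_cast
    field_simp
    linarith

theorem abs_arg_sub_arg_le {n : ℕ} (hn : 0 < n) {z w : ℂ} (h : sector n z = sector n w) :
    |z.arg - w.arg| ≤ 2 * Real.pi / n := by
  have hpi := Real.pi_pos
  have hn' : (0 : ℝ) < n := by exact_mod_cast hn
  have hc : 0 < 2 * Real.pi / (n : ℝ) := by positivity
  unfold sector at h
  have a1 := Int.le_ceil ((z.arg + Real.pi) / (2 * Real.pi / n))
  have a2 := Int.ceil_lt_add_one ((z.arg + Real.pi) / (2 * Real.pi / n))
  have b1 := Int.le_ceil ((w.arg + Real.pi) / (2 * Real.pi / n))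
  have b2 := Int.ceil_lt_add_one ((w.arg + Real.pi) / (2 * Real.pi / n))
  rw [h] at a1 a2
  have h3 : |(z.arg + Real.pi) / (2 * Real.pi / n) - (w.arg + Real.pi) / (2 * Real.pi / n)| ≤ 1 := by
    rw [abs_le]; constructor <;> linarith
  rw [← sub_div, abs_div, abs_of_pos hc, div_le_one hc] at h3
  simpa using h3

theorem re_mul_conj_eq (z w : ℂ) :
    z.re * w.re + z.im * w.im = ‖z‖ * ‖w‖ * Real.cos (z.arg - w.arg) := by
  rw [Real.cos_sub]
  linear_combination (-w.re) * Complex.norm_mul_cos_arg z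
    - ‖z‖ * Real.cos z.arg * Complex.norm_mul_cos_arg w
    - w.im * Complex.norm_mul_sin_arg z - ‖z‖ * Real.sin z.arg * Complex.norm_mul_sin_arg w

/-- This is where 18 sectors suffice: `(π/9)²/2 ≤ 1/16`. With `c = cos (θ/2)`, the left side is at
most `1 - c²`, and the right side is `(1 - c)(1 + 2c)`. -/
theorem one_sub_cos_mul_sin_sq_le {θ : ℝ} (h0 : 0 ≤ θ) (h1 : θ ≤ Real.pi / 4) :
    (1 - Real.cos (2 * Real.pi / 18)) * Real.sin (2 * θ) ^ 2 ≤
      Real.cos (θ / 2) - Real.cos θ := by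
  have hpi := Real.pi_pos
  have hpi2 := Real.pi_lt_d2
  have hk : 1 - Real.cos (2 * Real.pi / 18) ≤ 1 / 16 := by
    have := Real.one_sub_sq_div_two_le_cos (x := 2 * Real.pi / 18)
    nlinarith
  set c := Real.cos (θ / 2) with hc
  have hc0 : 0 ≤ c := Real.cos_nonneg_of_mem_Icc ⟨by linarith, by linarith⟩
  have hc1 : c ≤ 1 := Real.cos_le_one _
  have hct : Real.cos θ = 2 * c ^ 2 - 1 := by
    rw [hc, ← Real.cos_two_mul]; ring_nf
  have hst : Real.sin θ ^ 2 = 4 * (1 - c ^ 2) * c ^ 2 := by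
    have := Real.sin_sq_add_cos_sq θ
    rw [hct] at this; linarith
  have hs2 : Real.sin (2 * θ) ^ 2 ≤ 16 * (1 - c ^ 2) := by
    have h2 : Real.cos θ ^ 2 ≤ 1 := Real.cos_sq_le_one θ
    have h3 : c ^ 2 ≤ 1 := by nlinarith
    have h4 : Real.sin θ ^ 2 ≤ 4 * (1 - c ^ 2) := by rw [hst]; nlinarith
    rw [Real.sin_two_mul, mul_pow, mul_pow]
    nlinarith [sq_nonneg (Real.sin θ), sq_nonneg (Real.cos θ)]
  have h5 := mul_le_mul hk hs2 (sq_nonneg _) (by norm_num)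
  rw [hct]
  nlinarith

/-- An annulus `θ ≤ angle · p ≤ 2 θ` on the unit sphere of a three-dimensional space splits into
`36` pieces of angular diameter at most `θ`: two rings, each cut into `18` sectors. -/
theorem exists_partition_annulus (p : EuclideanSpace ℝ (Fin 3)) (hp : ‖p‖ = 1) {θ : ℝ}
    (h0 : 0 ≤ θ) (h1 : θ ≤ Real.pi / 4) :
    ∃ f : EuclideanSpace ℝ (Fin 3) → Bool × ℤ,
      (∀ x, f x ∈ (Finset.univ : Finset Bool) ×ˢ Finset.Icc (1 : ℤ) 18) ∧
      ∀ x y, ‖x‖ = 1 → ‖y‖ = 1 → θ ≤ angle x p → angle x p ≤ 2 * θ →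
        θ ≤ angle y p → angle y p ≤ 2 * θ → f x = f y → angle x y ≤ θ := by
  have hpi := Real.pi_pos
  obtain ⟨b, hb⟩ : ∃ b : OrthonormalBasis (Fin 3) ℝ (EuclideanSpace ℝ (Fin 3)), b 0 = p := by
    have hv : Orthonormal ℝ (({0} : Set (Fin 3)).domRestrict fun _ => p) := by
      rw [orthonormal_iff_ite]
      rintro ⟨i, rfl⟩ ⟨j, rfl⟩
      simp [Set.domRestrict, hp]
    obtain ⟨b, hb⟩ := hv.exists_orthonormalBasis_extension_of_card_eq (by simp)
    exact ⟨b, hb 0 rfl⟩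
  have hin : ∀ x y, inner ℝ x y = inner ℝ x p * inner ℝ y p +
      (inner ℝ x (b 1) * inner ℝ y (b 1) + inner ℝ x (b 2) * inner ℝ y (b 2)) := by
    intro x y
    rw [← b.sum_inner_mul_inner x y, Fin.sum_univ_three, hb, real_inner_comm y p,
      real_inner_comm y (b 1), real_inner_comm y (b 2)]
    ring
  -- The component orthogonal to `p`, as a complex number; its argument is the longitude around `p`.
  let z : EuclideanSpace ℝ (Fin 3) → ℂ := fun x => ⟨inner ℝ x (b 1), inner ℝ x (b 2)⟩
  have hz : ∀ x, ‖x‖ = 1 → ‖z x‖ = Real.sin (angle x p) := by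
    intro x hx
    refine (pow_left_inj₀ (norm_nonneg _) (sin_angle_nonneg x p) two_ne_zero).1 ?_
    have h2 := hin x x
    rw [real_inner_self_eq_norm_sq, hx, ← cos_angle_of_norm_eq_one hx hp] at h2
    have h3 := Real.sin_sq_add_cos_sq (angle x p)
    rw [← Complex.normSq_eq_norm_sq, Complex.normSq_apply]
    linarith
  refine ⟨fun x => (decide (angle x p ≤ 3 / 2 * θ), sector 18 (z x)), fun x => ?_, ?_⟩
  · exact Finset.mem_product.2 ⟨Finset.mem_univ _, by simpa using sector_mem (n := 18) (by simp) (z x)⟩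
  intro x y hx hy hx1 hx2 hy1 hy2 hxy
  obtain ⟨hr, hs⟩ := Prod.ext_iff.1 hxy
  simp only [decide_eq_decide] at hr hs
  have harg := abs_arg_sub_arg_le (by simp) hs
  -- The rings meet at `3θ/2`, so each has angular width `θ/2`.
  have hrho : |angle x p - angle y p| ≤ θ / 2 := by
    rw [abs_le]
    by_cases h : angle x p ≤ 3 / 2 * θ
    · have := hr.1 h; constructor <;> linarith
    · have h' := mt hr.2 h
      rw [not_le] at h h'
      constructor <;> linarith
  -- With `α`, `β` the angles to `p` and `δ` the difference of longitudes, `⟪x, y⟫ = cos (α - β) -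
  -- sin α sin β (1 - cos δ)`. The steps below bound this from below by `cos θ`.
  rw [← Real.strictAntiOn_cos.le_iff_ge ⟨h0, by linarith⟩ ⟨angle_nonneg x y, angle_le_pi x y⟩,
    cos_angle_of_norm_eq_one hx hy, hin]
  have hre := re_mul_conj_eq (z x) (z y)
  rw [hz x hx, hz y hy] at hre
  change inner ℝ x (b 1) * inner ℝ y (b 1) + inner ℝ x (b 2) * inner ℝ y (b 2) = _ at hre
  rw [hre, ← cos_angle_of_norm_eq_one hx hp, ← cos_angle_of_norm_eq_one hy hp]
  have c1 : Real.cos (2 * Real.pi / 18) ≤ Real.cos ((z x).arg - (z y).arg) := by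
    rw [← Real.cos_abs ((z x).arg - (z y).arg)]
    exact Real.cos_le_cos_of_nonneg_of_le_pi (abs_nonneg _) (by linarith) (by simpa using harg)
  have c2 : Real.cos (θ / 2) ≤ Real.cos (angle x p - angle y p) := by
    rw [← Real.cos_abs (angle x p - angle y p)]
    exact Real.cos_le_cos_of_nonneg_of_le_pi (abs_nonneg _) (by linarith) hrho
  have c3 := one_sub_cos_mul_sin_sq_le h0 h1
  have s1 : Real.sin (angle x p) ≤ Real.sin (2 * θ) :=
    Real.sin_le_sin_of_le_of_le_pi_div_two (by linarith) (by linarith) hx2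
  have s2 : Real.sin (angle y p) ≤ Real.sin (2 * θ) :=
    Real.sin_le_sin_of_le_of_le_pi_div_two (by linarith) (by linarith) hy2
  have s3 : Real.sin (angle x p) * Real.sin (angle y p) ≤ Real.sin (2 * θ) ^ 2 := by
    rw [sq]
    exact mul_le_mul s1 s2 (sin_angle_nonneg y p) ((sin_angle_nonneg x p).trans s1)
  have s0 := mul_nonneg (sin_angle_nonneg x p) (sin_angle_nonneg y p)
  have s4 := mul_le_mul_of_nonneg_left c1 s0
  have s5 := mul_le_mul_of_nonneg_left s3
    (sub_nonneg.2 (Real.cos_le_one (2 * Real.pi / 18)))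
  rw [Real.cos_sub] at c2
  linarith

/-- The unit sphere of a finite-dimensional space splits into finitely many pieces of angular
diameter at most `θ`, for each `θ > 0`. -/
theorem exists_partition_sphere [FiniteDimensional ℝ E] {θ : ℝ} (h0 : 0 < θ)
    (h1 : θ ≤ Real.pi) :
    ∃ N : ℕ, ∃ f : E → Fin N, ∀ x y, ‖x‖ = 1 → ‖y‖ = 1 → f x = f y → angle x y ≤ θ := by
  classical
  have hs : 0 < Real.sin (θ / 2) :=
    Real.sin_pos_of_pos_of_lt_pi (by linarith) (by linarith [Real.pi_pos])
  -- Two points in a common ball of radius `sin (θ/2)` have chord less than `2 sin (θ/2)`. The value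
  -- `none` serves vectors off the sphere.
  obtain ⟨t, -, ht, hcov⟩ :=
    (isCompact_sphere (0 : E) 1).finite_cover_balls hs
  have : Finite t := ht
  obtain ⟨N, ⟨g⟩⟩ := Finite.exists_equiv_fin (Option t)
  have hc : ∀ x : E, ‖x‖ = 1 → ∃ c : t, dist x c < Real.sin (θ / 2) := by
    intro x hx
    have := hcov (by simpa using hx : x ∈ Metric.sphere (0 : E) 1)
    simp only [Set.mem_iUnion, Metric.mem_ball, exists_prop] at this
    obtain ⟨c, hct, hcx⟩ := this
    exact ⟨⟨c, hct⟩, hcx⟩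
  refine ⟨N, fun x => g (if h : ‖x‖ = 1 then some (hc x h).choose else none), ?_⟩
  intro x y hx hy hxy
  simp only [hx, hy, dite_true, EmbeddingLike.apply_eq_iff_eq, Option.some.injEq] at hxy
  rw [← norm_sub_le_two_mul_sin_half_iff hx hy h0.le h1, ← dist_eq_norm]
  have a := (hc x hx).choose_spec
  have b := (hc y hy).choose_spec
  rw [hxy] at a
  have := dist_triangle_right x y ((hc y hy).choose : E)
  linarith

end Geometry

end ContentRec

namespace ContentRec

namespace Instance

variable {D : ℕ} (I : Instance D)

/-! ### Stable matchings -/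

/-- A matching which, used at all times, keeps all the users and creators that it involves. -/
def IsStable (R : I.Rec) : Prop :=
  ∀ i, R i ≠ ∅ → (R i).card = I.K ∧
    ∀ j ∈ R i, I.Happy i j ∧ I.abar ≤ I.audience Finset.univ R j

theorem inner_nonneg (i : Fin I.U) (j : Fin I.C) :
    (0 : ℝ) ≤ inner ℝ (I.user i) (I.creator j) := by
  rw [PiLp.inner_apply]
  refine Finset.sum_nonneg fun l _ => ?_
  simpa using mul_nonneg (I.creator_nonneg j l) (I.user_nonneg i l)

theorem inner_le_one (i : Fin I.U) (j : Fin I.C) :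
    (inner ℝ (I.user i) (I.creator j) : ℝ) ≤ 1 := by
  simpa [I.user_norm, I.creator_norm] using real_inner_le_norm (I.user i) (I.creator j)

theorem engagement_nonneg (S : Finset (Fin I.U)) (R : I.Rec) : 0 ≤ I.engagement S R :=
  Finset.sum_nonneg fun _ _ => Finset.sum_nonneg fun _ _ => I.inner_nonneg _ _

theorem engagement_congr {S S' : Finset (Fin I.U)} {R R' : I.Rec}
    (h : ∀ i ∈ S, R i = R' i) (hS : S ⊆ S') (h' : ∀ i ∉ S, R' i = ∅) :
    I.engagement S R = I.engagement S' R' := by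
  unfold engagement
  rw [← Finset.sum_subset hS fun i _ hi => by rw [h' i hi, Finset.sum_empty]]
  exact Finset.sum_congr rfl fun i hi => by rw [h i hi]

theorem averageEngagement_tendsto_of_forall_eq {R : ℕ → I.Rec} {e : ℝ}
    (h : ∀ t, I.engagement (I.population R t).1 (R t) = e) : I.HasLongTermEngagement R e := by
  refine tendsto_const_nhds.congr' ?_
  filter_upwards [Filter.eventually_gt_atTop 0] with T hT
  have : (T : ℝ) ≠ 0 := by exact_mod_cast hT.ne'
  simp only [averageEngagement, h, Finset.sum_const, Finset.card_range, nsmul_eq_mul]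
  field_simp

variable {I}

namespace IsStable

/-- Both claims need a joint induction: matched users stay because their creators are present and
suit them, and the creators stay because their whole audience does. -/
theorem population {R : I.Rec} (hR : I.IsStable R) (t : ℕ) :
    (∀ i, R i ≠ ∅ → i ∈ (I.population (fun _ => R) t).1) ∧
      ∀ i, R i ⊆ (I.population (fun _ => R) t).2 := by
  classical
  induction t with
  | zero => exact ⟨fun i _ => Finset.mem_univ i, fun i => Finset.subset_univ _⟩
  | succ t ih =>
    refine ⟨fun i hi => Finset.mem_filter.2 ⟨ih.1 i hi, (hR i hi).1, fun j hj =>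
      ((hR i hi).2 j hj).1⟩, fun i j hj => Finset.mem_filter.2 ⟨ih.2 i hj, ?_⟩⟩
    refine ((hR i (Finset.ne_empty_of_mem hj)).2 j hj).2.trans (Finset.card_le_card ?_)
    intro k hk
    have hk' := (Finset.mem_filter.1 hk).2
    exact Finset.mem_filter.2 ⟨ih.1 k (Finset.ne_empty_of_mem hk'), hk'⟩

theorem isRecAlgorithm {R : I.Rec} (hR : I.IsStable R) : I.IsRecAlgorithm fun _ => R := by
  refine fun t i _ => ⟨(hR.population t).2 i, ?_⟩
  by_cases h : R i = ∅
  · simp [h]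
  · exact (hR i h).1.le

theorem hasLongTermEngagement {R : I.Rec} (hR : I.IsStable R) :
    I.HasLongTermEngagement (fun _ => R) (I.engagement Finset.univ R) :=
  I.averageEngagement_tendsto_of_forall_eq fun t =>
    I.engagement_congr (fun _ _ => rfl) (Finset.subset_univ _) fun i hi =>
      not_not.1 fun h => hi ((hR.population t).1 i h)

theorem engagement_le {R : I.Rec} (hR : I.IsStable R) :
    I.engagement Finset.univ R ≤ I.U * I.K := by
  unfold engagement
  calc _ ≤ ∑ i : Fin I.U, (I.K : ℝ) := Finset.sum_le_sum fun i _ => ?_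
    _ = _ := by simp
  calc _ ≤ ∑ j ∈ R i, (1 : ℝ) := Finset.sum_le_sum fun j _ => I.inner_le_one i j
    _ = ((R i).card : ℝ) := by simp
    _ ≤ I.K := by
      by_cases h : R i = ∅
      · simp [h]
      · exact_mod_cast (hR i h).1.le

theorem le_engagement {R : I.Rec} (hR : I.IsStable R) :
    I.ebar * ((Finset.univ.filter fun i => R i ≠ ∅).card * I.K) ≤
      I.engagement Finset.univ R := by
  unfold engagement
  calc _ = ∑ i ∈ Finset.univ.filter (fun i => R i ≠ ∅), I.K * I.ebar := by
        rw [Finset.sum_const, nsmul_eq_mul]; ring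
    _ ≤ ∑ i ∈ Finset.univ.filter (fun i => R i ≠ ∅),
          ∑ j ∈ R i, (inner ℝ (I.user i) (I.creator j) : ℝ) := by
        refine Finset.sum_le_sum fun i hi => ?_
        obtain ⟨hc, hj⟩ := hR i (Finset.mem_filter.1 hi).2
        rw [← hc, ← nsmul_eq_mul]
        exact Finset.card_nsmul_le_sum _ _ _ fun j hij => (hj j hij).1
    _ ≤ _ := Finset.sum_le_sum_of_subset_of_nonneg (Finset.subset_univ _) fun i _ _ =>
        Finset.sum_nonneg fun _ _ => I.inner_nonneg _ _

end IsStable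

/-! ### Existence of forward-looking algorithms -/

theorem population_antitone (R : ℕ → I.Rec) : Antitone (I.population R) := by
  classical
  exact antitone_nat_of_succ_le fun _ => ⟨Finset.filter_subset _ _, Finset.filter_subset _ _⟩

/-- The matching used while the population does not change is stable. -/
theorem exists_isStable_of_population_eq {R : ℕ → I.Rec} (hR : I.IsRecAlgorithm R) {t : ℕ}
    (ht : I.population R (t + 1) = I.population R t) :
    ∃ R', I.IsStable R' ∧
      I.engagement (I.population R t).1 (R t) = I.engagement Finset.univ R' := by
  classical
  have h1 : I.stayingUsers (I.population R t).1 (R t) = (I.population R t).1 :=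
    congrArg Prod.fst ht
  have h2 : I.stayingCreators (I.population R t).1 (I.population R t).2 (R t) =
      (I.population R t).2 := congrArg Prod.snd ht
  -- Erasing the recommendations of absent users makes the audience over all users equal to that
  -- over present ones.
  refine ⟨fun i => if i ∈ (I.population R t).1 then R t i else ∅, fun i hi => ?_,
    I.engagement_congr (fun i hi => by simp [hi]) (Finset.subset_univ _)
      fun i hi => by simp [hi]⟩
  have hit : i ∈ (I.population R t).1 := by
    by_contra h
    simp [h] at hi
  simp only [hit, if_true]
  have hi' := hit
  rw [← h1] at hi'
  obtain ⟨-, hc, hh⟩ := Finset.mem_filter.1 hi'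
  refine ⟨hc, fun j hj => ⟨hh j hj, ?_⟩⟩
  have hjt := (hR t i hit).1 hj
  rw [← h2] at hjt
  refine (Finset.mem_filter.1 hjt).2.trans (Finset.card_le_card fun k hk => ?_)
  obtain ⟨hk1, hk2⟩ := Finset.mem_filter.1 hk
  exact Finset.mem_filter.2 ⟨Finset.mem_univ _, by simpa [hk1] using hk2⟩

theorem exists_isStable_of_eventually {R : ℕ → I.Rec} (hR : I.IsRecAlgorithm R) :
    ∃ t₀, ∀ t, t₀ ≤ t → ∃ R', I.IsStable R' ∧
      I.engagement (I.population R t).1 (R t) = I.engagement Finset.univ R' := by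
  obtain ⟨t₀, h⟩ := WellFoundedLT.antitone_chain_condition (population_antitone R)
  exact ⟨t₀, fun t ht => exists_isStable_of_population_eq hR
    ((h _ (ht.trans t.le_succ)).symm.trans (h t ht))⟩

/-- The finitely many rounds before the population settles contribute a fixed total `B`, which
vanishes in the average; each later round contributes at most `M`. -/
theorem le_of_hasLongTermEngagement {R : ℕ → I.Rec} (hR : I.IsRecAlgorithm R) {e M : ℝ}
    (he : I.HasLongTermEngagement R e)
    (hM : ∀ R', I.IsStable R' → I.engagement Finset.univ R' ≤ M) (hM0 : 0 ≤ M) : e ≤ M := by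
  obtain ⟨t₀, ht₀⟩ := exists_isStable_of_eventually hR
  set B := ∑ t ∈ Finset.range t₀, I.engagement (I.population R t).1 (R t)
  have hB : 0 ≤ B := Finset.sum_nonneg fun t _ => I.engagement_nonneg _ _
  have hsum : ∀ T, ∑ t ∈ Finset.range T, I.engagement (I.population R t).1 (R t) ≤ B + T * M := by
    intro T
    rw [← Finset.sum_filter_add_sum_filter_not _ fun t => t < t₀]
    refine add_le_add (Finset.sum_le_sum_of_subset_of_nonneg (fun t ht => ?_)
      fun t _ _ => I.engagement_nonneg _ _) ?_
    · exact Finset.mem_range.2 (Finset.mem_filter.1 ht).2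
    · refine (Finset.sum_le_card_nsmul _ _ M fun t ht => ?_).trans ?_
      · obtain ⟨R', h1, h2⟩ := ht₀ t (not_lt.1 (Finset.mem_filter.1 ht).2)
        rw [h2]
        exact hM R' h1
      · rw [nsmul_eq_mul]
        refine mul_le_mul_of_nonneg_right ?_ hM0
        exact_mod_cast (Finset.card_filter_le _ _).trans (Finset.card_range T).le
  have hlim : Filter.Tendsto (fun T : ℕ => B / T + M) Filter.atTop (nhds M) := by
    simpa using (tendsto_const_div_atTop_nhds_zero_nat B).add_const M
  refine le_of_tendsto_of_tendsto he hlim ?_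
  filter_upwards [Filter.eventually_gt_atTop 0] with T hT
  have hT' : (0 : ℝ) < T := by exact_mod_cast hT
  calc I.averageEngagement R T ≤ 1 / T * (B + T * M) :=
        mul_le_mul_of_nonneg_left (hsum T) (by positivity)
    _ = B / T + M := by field_simp

theorem isStable_empty : I.IsStable fun _ => ∅ := fun _ h => absurd rfl h

variable (I) in
theorem exists_isForwardLooking : ∃ F : ℕ → I.Rec, I.IsForwardLooking F := by
  classical
  obtain ⟨R, hR, hmax⟩ := Finset.exists_max_image (Finset.univ.filter fun R => I.IsStable R)
    (I.engagement Finset.univ) ⟨_, Finset.mem_filter.2 ⟨Finset.mem_univ _, isStable_empty⟩⟩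
  replace hR := (Finset.mem_filter.1 hR).2
  exact ⟨fun _ => R, hR.isRecAlgorithm, _, hR.hasLongTermEngagement, fun R' e' hR' he' =>
    le_of_hasLongTermEngagement hR' he'
      (fun R'' h => hmax R'' (Finset.mem_filter.2 ⟨Finset.mem_univ _, h⟩))
      (I.engagement_nonneg _ _)⟩

end Instance

end ContentRec

namespace ContentRec

namespace Instance

variable {D : ℕ} {I : Instance D}

open InnerProductGeometry

/-! ### The local-clustering algorithm -/

theorem mem_usersIn {i j : Fin I.U} :
    j ∈ I.usersIn i ↔ angle (I.user j) (I.user i) ≤ Real.arccos I.ebar / 2 := by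
  have h0 := Real.arccos_nonneg I.ebar
  have h1 := Real.arccos_le_pi I.ebar
  rw [← norm_sub_le_two_mul_sin_half_iff (I.user_norm j) (I.user_norm i) (by linarith)
    (by linarith)]
  simp only [usersIn, ball, neighborhoodRadius, Finset.mem_filter, Finset.mem_univ, true_and,
    mem_closedBall_iff_norm]
  rw [show Real.arccos I.ebar / 4 = Real.arccos I.ebar / 2 / 2 by ring]

theorem mem_creatorsIn {i : Fin I.U} {k : Fin I.C} :
    k ∈ I.creatorsIn i ↔ angle (I.creator k) (I.user i) ≤ Real.arccos I.ebar / 2 := by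
  have h0 := Real.arccos_nonneg I.ebar
  have h1 := Real.arccos_le_pi I.ebar
  rw [← norm_sub_le_two_mul_sin_half_iff (I.creator_norm k) (I.user_norm i) (by linarith)
    (by linarith)]
  simp only [creatorsIn, ball, neighborhoodRadius, Finset.mem_filter, Finset.mem_univ, true_and,
    mem_closedBall_iff_norm]
  rw [show Real.arccos I.ebar / 4 = Real.arccos I.ebar / 2 / 2 by ring]

theorem mem_usersIn_self (i : Fin I.U) : i ∈ I.usersIn i := by
  rw [mem_usersIn, angle_self (norm_ne_zero_iff.1 (by simp [I.user_norm]))]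
  have := Real.arccos_nonneg I.ebar
  linarith

theorem mem_unassignedIn {R : I.Rec} {i j : Fin I.U} :
    j ∈ I.unassignedIn R i ↔ j ∈ I.usersIn i ∧ R j = ∅ :=
  Finset.mem_filter

/-- Users are happy with the creators of a common neighborhood ball. -/
theorem happy_of_mem {p i : Fin I.U} {k : Fin I.C} (hi : i ∈ I.usersIn p)
    (hk : k ∈ I.creatorsIn p) : I.Happy i k := by
  rw [mem_usersIn] at hi
  rw [mem_creatorsIn, angle_comm] at hk
  have h := angle_le_angle_add_angle (I.user i) (I.user p) (I.creator k)
  have h0 := I.ebar_nonneg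
  rw [Happy, ← cos_angle_of_norm_eq_one (I.user_norm i) (I.creator_norm k),
    ← Real.cos_arccos (by linarith) I.ebar_le_one]
  -- Two angles of at most `arccos ē / 2` add up to at most `arccos ē`.
  exact Real.cos_le_cos_of_nonneg_of_le_pi (angle_nonneg _ _) (Real.arccos_le_pi _)
    (by linarith)

/-- What is known about the recommendations `R` when the local-clustering algorithm has examined
the users of `S`: it has assigned the neighborhood balls of the users of `P`, and the user `j` was
assigned with the ball of `cl j`. -/
structure IsClustering (pick : Fin I.U → Finset (Fin I.C)) (S : Set (Fin I.U)) (R : I.Rec)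
    (P : Finset (Fin I.U)) (cl : Fin I.U → Fin I.U) : Prop where
  center : ∀ j, R j ≠ ∅ → cl j ∈ P ∧ j ∈ I.usersIn (cl j) ∧ R j = pick (cl j)
  abar_le_card : ∀ p ∈ P, I.abar ≤ (Finset.univ.filter fun j => R j ≠ ∅ ∧ cl j = p).card
  assigned : ∀ p ∈ P, ∀ j ∈ I.usersIn p, R j ≠ ∅
  card_lt : ∀ i ∈ S, R i = ∅ → (I.unassignedIn R i).card < I.abar

variable {pick : Fin I.U → Finset (Fin I.C)}

theorem IsClustering.lcStep (hd : I.Dense) (hp : I.IsPick pick) {S : Set (Fin I.U)} {R : I.Rec}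
    {P : Finset (Fin I.U)} {cl : Fin I.U → Fin I.U} (h : IsClustering pick S R P cl)
    (i : Fin I.U) : ∃ P' cl', IsClustering pick (insert i S) (I.lcStep pick R i) P' cl' := by
  classical
  unfold Instance.lcStep
  split_ifs with hc
  · obtain ⟨hi, ha, hK⟩ := hc
    -- Since `K ≥ 1`, an empty recommendation set marks exactly the unassigned users.
    have hpick : pick i ≠ ∅ := by
      rw [← Finset.card_pos.trans Finset.nonempty_iff_ne_empty, (hp i hK).2]
      exact I.K_pos
    have hiP : i ∉ P := fun hiP => h.assigned i hiP i (mem_usersIn_self i) hi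
    have hne : ∀ j, (if j ∈ I.unassignedIn R i then pick i else R j) ≠ ∅ ↔
        j ∈ I.unassignedIn R i ∨ R j ≠ ∅ := by
      intro j
      by_cases hj : j ∈ I.unassignedIn R i <;> simp [hj, hpick]
    refine ⟨insert i P, fun j => if j ∈ I.unassignedIn R i then i else cl j, ?_, ?_, ?_, ?_⟩
    · intro j hj
      by_cases hju : j ∈ I.unassignedIn R i
      · simp [hju, (mem_unassignedIn.1 hju).1]
      · obtain ⟨h1, h2, h3⟩ := h.center j (((hne j).1 hj).resolve_left hju)
        simp only [hju, if_false]
        exact ⟨Finset.mem_insert_of_mem h1, h2, h3⟩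
    · intro p hpP
      rcases Finset.mem_insert.1 hpP with rfl | hpP
      · refine ha.trans (Finset.card_le_card fun j hj => Finset.mem_filter.2
          ⟨Finset.mem_univ _, (hne j).2 (Or.inl hj), by simp [hj]⟩)
      · refine (h.abar_le_card p hpP).trans (Finset.card_le_card fun j hj => ?_)
        obtain ⟨-, h1, h2⟩ := Finset.mem_filter.1 hj
        have hju : j ∉ I.unassignedIn R i := fun hju => h1 (mem_unassignedIn.1 hju).2
        exact Finset.mem_filter.2 ⟨Finset.mem_univ _, (hne j).2 (Or.inr h1), by simp [hju, h2]⟩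
    · intro p hpP j hj
      rw [hne]
      rcases Finset.mem_insert.1 hpP with rfl | hpP
      · by_cases hR : R j = ∅
        · exact Or.inl (mem_unassignedIn.2 ⟨hj, hR⟩)
        · exact Or.inr hR
      · exact Or.inr (h.assigned p hpP j hj)
    · intro k hk hRk
      have hk' : ¬(k ∈ I.unassignedIn R i ∨ R k ≠ ∅) := mt (hne k).2 (not_not.2 hRk)
      rw [not_or, not_not] at hk'
      have hki : k ≠ i := by
        rintro rfl
        exact hk'.1 (mem_unassignedIn.2 ⟨mem_usersIn_self k, hi⟩)
      -- Unassigned sets only shrink, so earlier bounds persist.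
      refine (Finset.card_le_card fun j hj => ?_).trans_lt
        (h.card_lt k ((Set.mem_insert_iff.1 hk).resolve_left hki) hk'.2)
      obtain ⟨h1, h2⟩ := mem_unassignedIn.1 hj
      have hj' : ¬(j ∈ I.unassignedIn R i ∨ R j ≠ ∅) := mt (hne j).2 (not_not.2 h2)
      rw [not_or, not_not] at hj'
      exact mem_unassignedIn.2 ⟨h1, hj'.2⟩
  · refine ⟨P, cl, h.center, h.abar_le_card, h.assigned, fun k hk hRk => ?_⟩
    rcases Set.mem_insert_iff.1 hk with rfl | hk
    · by_contra hlt
      -- By density there are enough creators, so an unassigned user is passed over only for lack of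
      -- unassigned users.
      exact hc ⟨hRk, not_lt.1 hlt, (hd k).2⟩
    · exact h.card_lt k hk hRk

theorem IsClustering.foldl (hd : I.Dense) (hp : I.IsPick pick) (l : List (Fin I.U))
    {S : Set (Fin I.U)} {R : I.Rec} {P : Finset (Fin I.U)} {cl : Fin I.U → Fin I.U}
    (h : IsClustering pick S R P cl) :
    ∃ P' cl', IsClustering pick (S ∪ {i | i ∈ l}) (l.foldl (I.lcStep pick) R) P' cl' := by
  induction l generalizing S R P cl with
  | nil => exact ⟨P, cl, by simpa using h⟩
  | cons i l ih =>
    obtain ⟨P', cl', h'⟩ := h.lcStep hd hp i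
    obtain ⟨P'', cl'', h''⟩ := ih h'
    refine ⟨P'', cl'', ?_⟩
    have : S ∪ {k | k ∈ i :: l} = insert i S ∪ {k | k ∈ l} := by
      ext k
      simp only [Set.mem_union, Set.mem_ofPred_eq, List.mem_cons, Set.mem_insert_iff]
      tauto
    rw [this]
    exact h''

theorem exists_isClustering_lcOutput (hd : I.Dense) (hp : I.IsPick pick)
    (order : Equiv.Perm (Fin I.U)) :
    ∃ P cl, IsClustering pick Set.univ (I.lcOutput order pick) P cl := by
  have h0 : IsClustering pick ∅ (fun _ => ∅) ∅ id :=
    ⟨fun _ h => absurd rfl h, by simp, by simp, by simp⟩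
  obtain ⟨P, cl, h⟩ := h0.foldl hd hp (List.ofFn order)
  refine ⟨P, cl, ?_⟩
  have : (∅ ∪ {i | i ∈ List.ofFn order} : Set (Fin I.U)) = Set.univ := by
    ext i
    simpa [List.mem_ofFn] using order.surjective i
  rwa [this] at h

/-! ### Stability of the final clustering and the count of assigned users -/

namespace IsClustering

variable {R : I.Rec} {P : Finset (Fin I.U)} {cl : Fin I.U → Fin I.U}

theorem isStable (hd : I.Dense) (hp : I.IsPick pick) (h : IsClustering pick Set.univ R P cl) :
    I.IsStable R := by
  intro i hi
  obtain ⟨h1, h2, h3⟩ := h.center i hi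
  obtain ⟨h4, h5⟩ := hp (cl i) (hd (cl i)).2
  rw [h3]
  refine ⟨h5, fun j hj => ⟨happy_of_mem h2 (h4 hj), (h.abar_le_card _ h1).trans
    (Finset.card_le_card fun k hk => ?_)⟩⟩
  obtain ⟨-, hk1, hk2⟩ := Finset.mem_filter.1 hk
  refine Finset.mem_filter.2 ⟨Finset.mem_univ _, ?_⟩
  rw [(h.center k hk1).2.2, hk2]
  exact hj

/-- Every unassigned user has an assigned user in her neighborhood ball. -/
theorem exists_mem_center (hd : I.Dense) (h : IsClustering pick Set.univ R P cl) {i : Fin I.U}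
    (hi : R i = ∅) : ∃ p ∈ P, i ∉ I.usersIn p ∧ ∃ j, j ∈ I.usersIn i ∧ j ∈ I.usersIn p := by
  have hlt := (h.card_lt i (Set.mem_univ i) hi).trans_le (hd i).1
  obtain ⟨j, hj, hju⟩ := Finset.exists_mem_notMem_of_card_lt_card hlt
  have hR : R j ≠ ∅ := fun hR => hju (mem_unassignedIn.2 ⟨hj, hR⟩)
  obtain ⟨h1, h2, -⟩ := h.center j hR
  exact ⟨cl j, h1, fun h3 => h.assigned _ h1 i h3 hi, j, hj, h2⟩

theorem nonempty (hd : I.Dense) (h : IsClustering pick Set.univ R P cl) : P.Nonempty := by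
  let i : Fin I.U := ⟨0, I.U_pos⟩
  by_cases hi : R i = ∅
  · obtain ⟨p, hp, -⟩ := h.exists_mem_center hd hi
    exact ⟨p, hp⟩
  · exact ⟨_, (h.center i hi).1⟩

/-- If the unassigned users fall into `N` classes per center, so that users in the same class are
in each other's neighborhood balls, then at least one user in `N + 1` is assigned. -/
theorem card_le {κ : Type*} [DecidableEq κ] (h : IsClustering pick Set.univ R P cl)
    (g : Fin I.U → κ) (T : Finset κ) {N : ℕ} (hT : T.card ≤ N * P.card)
    (hg : ∀ i, R i = ∅ → g i ∈ T)
    (hgg : ∀ i j, R i = ∅ → R j = ∅ → g i = g j → j ∈ I.usersIn i) :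
    I.U ≤ (N + 1) * (Finset.univ.filter fun i => R i ≠ ∅).card := by
  -- A nonempty class lies within the unassigned part of the ball of any of its members.
  have h1 : (Finset.univ.filter fun i => R i = ∅).card ≤ I.abar * T.card := by
    refine Finset.card_le_mul_card_image_of_maps_to (f := g)
      (fun i hi => hg i (Finset.mem_filter.1 hi).2) _ fun b _ => ?_
    rcases Finset.eq_empty_or_nonempty
      ((Finset.univ.filter fun i => R i = ∅).filter fun i => g i = b) with he | ⟨i, hi⟩
    · rw [he]; simp
    · obtain ⟨hi1, rfl⟩ := Finset.mem_filter.1 hi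
      have hi2 := (Finset.mem_filter.1 hi1).2
      refine (Finset.card_le_card fun j hj => ?_).trans (h.card_lt i (Set.mem_univ i) hi2).le
      obtain ⟨hj1, hj3⟩ := Finset.mem_filter.1 hj
      have hj2 := (Finset.mem_filter.1 hj1).2
      exact mem_unassignedIn.2 ⟨hgg i j hi2 hj2 hj3.symm, hj2⟩
  -- The fibers of `cl` over the centers are disjoint, with at least `ā` assigned users each.
  have h2 : P.card * I.abar ≤ (Finset.univ.filter fun i => R i ≠ ∅).card := by
    rw [mul_comm]
    refine Finset.mul_card_image_le_card_of_maps_to (f := cl)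
      (fun i hi => (h.center i (Finset.mem_filter.1 hi).2).1) _ fun p hp => ?_
    rw [Finset.filter_filter]
    exact h.abar_le_card p hp
  have h3 := Finset.card_filter_add_card_filter_not (s := Finset.univ) fun i => R i = ∅
  rw [Finset.card_univ, Fintype.card_fin] at h3
  have h4 : I.abar * T.card ≤ N * (P.card * I.abar) := by
    calc _ ≤ I.abar * (N * P.card) := Nat.mul_le_mul_left _ hT
      _ = _ := by ring
  have h5 := Nat.mul_le_mul_left N h2
  simp only [ne_eq] at *
  linarith

end IsClustering

end Instance

end ContentRec

namespace ContentRec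

namespace Instance

open InnerProductGeometry

/-! ### The share of assigned users -/

theorem IsClustering.card_le_of_three {I : Instance 3} {pick : Fin I.U → Finset (Fin I.C)}
    {R : I.Rec} {P : Finset (Fin I.U)} {cl : Fin I.U → Fin I.U} (hd : I.Dense)
    (h : IsClustering pick Set.univ R P cl) :
    I.U ≤ 37 * (Finset.univ.filter fun i => R i ≠ ∅).card := by
  classical
  have h0 := Real.arccos_nonneg I.ebar
  have h1 := Real.arccos_le_pi_div_two.2 I.ebar_nonneg
  set θ := Real.arccos I.ebar / 2 with hθ
  choose f hfm hf using fun p : Fin I.U =>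
    exists_partition_annulus (I.user p) (I.user_norm p) (θ := θ) (by linarith) (by linarith)
  -- The condition sits under the quantifier so that `c` is total; its value at assigned users is
  -- irrelevant.
  have hc : ∀ i, ∃ p, R i = ∅ → p ∈ P ∧ θ ≤ angle (I.user i) (I.user p) ∧
      angle (I.user i) (I.user p) ≤ 2 * θ := by
    intro i
    by_cases hi : R i = ∅
    · obtain ⟨p, hp, hip, j, hji, hjp⟩ := h.exists_mem_center hd hi
      rw [mem_usersIn] at hip hji hjp
      rw [angle_comm] at hji
      have := angle_le_angle_add_angle (I.user i) (I.user j) (I.user p)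
      exact ⟨p, fun _ => ⟨hp, by linarith, by linarith⟩⟩
    · exact ⟨i, fun h => absurd h hi⟩
  choose c hc using hc
  refine h.card_le (N := 36) (fun i => (c i, f (c i) (I.user i)))
    (P ×ˢ (Finset.univ ×ˢ Finset.Icc 1 18)) ?_ ?_ ?_
  · simp [Finset.card_product, mul_comm]
  · exact fun i hi => Finset.mem_product.2 ⟨(hc i hi).1, hfm _ _⟩
  · intro i j hi hj hij
    obtain ⟨hij1, hij2⟩ := Prod.ext_iff.1 hij
    dsimp only at hij1 hij2
    obtain ⟨-, a1, a2⟩ := hc i hi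
    obtain ⟨-, b1, b2⟩ := hc j hj
    rw [← hij1] at b1 b2 hij2
    rw [mem_usersIn]
    exact hf _ _ _ (I.user_norm j) (I.user_norm i) b1 b2 a1 a2 hij2.symm

/-- `N` is chosen before the instance, so that it depends on `e` and `D` alone. One partition of the
whole sphere serves all centers together. -/
theorem exists_forall_card_le (e : ℝ) (D : ℕ) : ∃ N : ℕ, ∀ I : Instance D, I.ebar = e →
    I.Dense → ∀ (pick : Fin I.U → Finset (Fin I.C)) (R : I.Rec) (P : Finset (Fin I.U))
      (cl : Fin I.U → Fin I.U), IsClustering pick Set.univ R P cl →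
      I.U ≤ (N + 1) * (Finset.univ.filter fun i => R i ≠ ∅).card := by
  classical
  rcases lt_or_ge e 1 with he | he
  · have hpos := Real.arccos_pos.2 he
    have hpi := Real.arccos_le_pi e
    obtain ⟨N, f, hf⟩ := exists_partition_sphere (E := EuclideanSpace ℝ (Fin D))
      (θ := Real.arccos e / 2) (by linarith) (by linarith)
    refine ⟨N, ?_⟩
    rintro I rfl hd pick R P cl h
    refine h.card_le (fun i => f (I.user i)) Finset.univ ?_ (fun _ _ => Finset.mem_univ _) ?_
    · simpa using Nat.le_mul_of_pos_right N (Finset.card_pos.2 (h.nonempty hd))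
    · intro i j _ _ hij
      rw [mem_usersIn]
      exact hf _ _ (I.user_norm j) (I.user_norm i) hij.symm
  -- At `ē = 1` pieces of diameter `0` would be needed, but balls meet the sphere only in their
  -- centers: an assigned user in the ball of `i` has the type of `i`, so nobody stays unassigned.
  · refine ⟨0, ?_⟩
    rintro I rfl hd pick R P cl h
    have key : ∀ i, R i ≠ ∅ := by
      intro i hi
      obtain ⟨p, -, hip, j, hji, hjp⟩ := h.exists_mem_center hd hi
      rw [mem_usersIn, Real.arccos_eq_zero.2 he] at hip hji hjp
      rw [angle_comm] at hji
      have := angle_le_angle_add_angle (I.user i) (I.user j) (I.user p)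
      exact hip (by linarith)
    refine h.card_le id ∅ (by simp) (fun i hi => absurd hi (key i)) fun i _ hi => absurd hi (key i)

/-- Compares the lower bound `ē K` per assigned user with the upper bound `U * K` on any engagement
`e`. -/
theorem div_le_of_card_le {D : ℕ} {I : Instance D} {R : I.Rec} (hR : I.IsStable R) {n : ℕ}
    (hn : 0 < n) (hU : I.U ≤ n * (Finset.univ.filter fun i => R i ≠ ∅).card) {e : ℝ}
    (he : 0 < e) (he' : e ≤ I.U * I.K) : I.ebar / n ≤ I.engagement Finset.univ R / e := by
  have hn' : (0 : ℝ) < n := by exact_mod_cast hn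
  have hU' : (I.U : ℝ) ≤ n * (Finset.univ.filter fun i => R i ≠ ∅).card := by exact_mod_cast hU
  rw [div_le_div_iff₀ hn' he]
  calc I.ebar * e ≤ I.ebar * (n * (Finset.univ.filter fun i => R i ≠ ∅).card * I.K) :=
        mul_le_mul_of_nonneg_left
          (he'.trans (mul_le_mul_of_nonneg_right hU' (Nat.cast_nonneg _))) I.ebar_nonneg
    _ = n * (I.ebar * ((Finset.univ.filter fun i => R i ≠ ∅).card * I.K)) := by ring
    _ ≤ n * I.engagement Finset.univ R := mul_le_mul_of_nonneg_left hR.le_engagement hn'.le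
    _ = _ := mul_comm _ _

end Instance

end ContentRec

end

/-! ### Choice of `r` and conclusion -/

theorem mainTheorem6 :
    ∃ r : ℝ → ℕ → ℝ,
      (∀ (e : ℝ) (D : ℕ), 0 < e → e ≤ 1 → 2 ≤ D → 0 < r e D) ∧
      (∀ e : ℝ, 0 ≤ e → e ≤ 1 → e / 37 ≤ r e 3) ∧
      ∀ (D : ℕ), 2 ≤ D → ∀ I : ContentRec.Instance D, I.Dense →
        (∃ F : ℕ → I.Rec, I.IsForwardLooking F) ∧
        ∀ (order : Equiv.Perm (Fin I.U)) (pick : Fin I.U → Finset (Fin I.C)), I.IsPick pick →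
          I.IsRecAlgorithm (I.localClustering order pick) ∧
          ∃ eLC : ℝ, I.HasLongTermEngagement (I.localClustering order pick) eLC ∧
            ∀ (F : ℕ → I.Rec) (eFL : ℝ),
              I.IsForwardLooking F → I.HasLongTermEngagement F eFL →
              (0 < I.ebar → 0 < eFL) ∧ (0 < eFL → r I.ebar D ≤ eLC / eFL) := by
  choose N hN using ContentRec.Instance.exists_forall_card_le
  refine ⟨fun e D => if D = 3 then e / (37 : ℕ) else e / (N e D + 1 : ℕ), ?_, by simp, ?_⟩
  · intro e D he _ _
    dsimp only
    split_ifs <;> positivity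
  intro D _ I hd
  refine ⟨I.exists_isForwardLooking, fun order pick hp => ?_⟩
  obtain ⟨P, cl, h⟩ := ContentRec.Instance.exists_isClustering_lcOutput hd hp order
  have hR := h.isStable hd hp
  refine ⟨hR.isRecAlgorithm, _, hR.hasLongTermEngagement, fun F eFL hF heFL => ⟨fun he => ?_,
    fun hpos => ?_⟩⟩
  · obtain ⟨-, e, he', hmax⟩ := hF
    obtain rfl := tendsto_nhds_unique heFL he'
    refine lt_of_lt_of_le ?_ (hmax _ _ hR.isRecAlgorithm hR.hasLongTermEngagement)
    refine lt_of_lt_of_le ?_ hR.le_engagement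
    have hK : (0 : ℝ) < I.K := by exact_mod_cast I.K_pos
    -- At least one user is assigned, since `U ≥ 1` is at most a multiple of their number.
    have hA : 0 < (Finset.univ.filter fun i => I.lcOutput order pick i ≠ ∅).card :=
      Nat.pos_of_mul_pos_left (I.U_pos.trans (hN _ _ I rfl hd _ _ _ _ h))
    have hA' : (0 : ℝ) < (Finset.univ.filter fun i => I.lcOutput order pick i ≠ ∅).card := by
      exact_mod_cast hA
    positivity
  · have hle : eFL ≤ I.U * I.K := ContentRec.Instance.le_of_hasLongTermEngagement hF.1 heFL
      (fun R' hR' => hR'.engagement_le) (by positivity)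
    dsimp only
    split_ifs with hD
    · subst hD
      exact ContentRec.Instance.div_le_of_card_le hR (by norm_num) (h.card_le_of_three hd) hpos hle
    · exact ContentRec.Instance.div_le_of_card_le hR (by positivity)
        (hN _ _ I rfl hd _ _ _ _ h) hpos hle
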